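/- **Standing data.** Let $E$ be a commutative unital C*-algebra with unitary group $\mathcal U(E)$. Let $T$ be a group with neutral element $1$ that is the union of an increasing sequence $\{1\}=T_0\subseteq T_1\subseteq T_2\subseteq\cdots$ of finite subgroups, and let $f\colon T\times T\to\mathcal U(E)$ be a Schur $E$-function, i.e. $f(1,1)=1_E$ and $f(r,s)f(rs,t)=f(r,st)f(s,t)$ for all $r,s,t\in T$. An *$E$-C\*-algebra* is a C*-algebra $F$ with a bilinear map $E\times F\to F$, $(\alpha,x)\mapsto\alpha x$, such that $1_Ex=x$, $(\alpha\beta)x=\alpha(\beta x)$, $\alpha(xy)=(\alpha x)y=x(\alpha y)$, $(\alpha x)^*=\alpha^*x^*$ and $\|\alpha x\|\le\|\alpha\|\,\|x\|$. Morphisms are the $E$-linear $*$-homomorphisms. A *full $E$-C\*-algebra* is a unital C*-algebra $R$ containing $E$ as a unital C*-subalgebra of its centre; here the morphisms considered are the unital $E$-linear $*$-homomorphisms. For a full $E$-C*-algebra $R$ and $n\ge 0$ let $R_n$ be the unital $*$-algebra of operators $\sum_{t\in T_n}(X_t\otimes \mathrm{id})V_t$, $X_t\in R$, on the Hilbert $R$-module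 $R^{T_n}$, where $((x\otimes \mathrm{id})\xi)(s)=x\,\xi(s)$ and $(V_t\xi)(s)=f(t,t^{-1}s)\,\xi(t^{-1}s)$. For $m\le n$ regard $R_m\subseteq R_n$ and $E_n\subseteq R_n$ in the canonical way (same coefficients $X_t$). Fix elements $C_n\in E_n$ ($n\ge1$) commuting with $E_{n-1}$ and such that $A_n:=C_n^*C_n$ and $B_n:=C_nC_n^*$ are projections with $A_n+B_n=1$. Let $R_\to$ be the algebraic inductive limit of the sequence $R_0\to R_1\to R_2\to\cdots$ with maps $R_{n-1}\to R_n$, $X\mapsto A_nX$. For projections (self-adjoint idempotents) $P,Q\in R_\to$ write $P\sim_0 Q$ if $P=X^*X$ and $Q=XX^*$ for some $X\in R_\to$. The set of $\sim_0$-classes is an abelian monoid under $[P]\oplus[Q]=[P'+Q']$, where $P'\sim_0P$, $Q'\sim_0Q$, $P'Q'=0$; $K_0(R)$ is its Grothendieck group. A unital $E$-linear $*$-homomorphism $R\to S$ of full $E$-C*-algebras induces a homomorphism $K_0(R)\to K_0(S)$ by acting on the coefficients $X_t$. For an $E$-C*-algebra $F$ let $\check F=E\times F$ with $(\alpha,x)(\beta,y)=(\alpha\beta,\alpha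 y+\beta x+xy)$ and $(\alpha,x)^*=(\alpha^*,x^*)$, let $\pi^F\colon\check F\to E$, $(\alpha,x)\mapsto\alpha$, and put $K_0(F):=\ker\bigl(K_0(\pi^F)\colon K_0(\check F)\to K_0(E)\bigr)$. For a morphism $\varphi\colon F\to G$ of $E$-C*-algebras, $K_0(\varphi)\colon K_0(F)\to K_0(G)$ is the restriction of $K_0(\check\varphi)$, where $\check\varphi(\alpha,x)=(\alpha,\varphi(x))$. Morphisms $\varphi,\psi\colon F\to G$ of $E$-C*-algebras are *homotopic* if there are morphisms $\phi_s\colon F\to G$, $s\in[0,1]$, with $\phi_0=\varphi$, $\phi_1=\psi$ and $s\mapsto\phi_s(x)$ continuous for every $x\in F$. A pair $\varphi\colon F\to G$, $\psi\colon G\to F$ is a *homotopy* if $\psi\circ\varphi$ is homotopic to $\mathrm{id}_F$ and $\varphi\circ\psi$ is homotopic to $\mathrm{id}_G$; if such a pair exists, $F$ and $G$ are called *homotopic*. **Theorem (Homotopy invariance of $K_0$).** Let $F,G$ be $E$-C*-algebras. (a) If $\varphi,\psi\colon F\to G$ are homotopic morphisms, then $K_0(\varphi)=K_0(\psi)$.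 (b) If $\varphi\colon F\to G$, $\psi\colon G\to F$ is a homotopy, then $K_0(\varphi)\circ K_0(\psi)=\mathrm{id}_{K_0(G)}$ and $K_0(\psi)\circ K_0(\varphi)=\mathrm{id}_{K_0(F)}$. (c) If $F$ and $G$ are homotopic, then the groups $K_0(F)$ and $K_0(G)$ are isomorphic. (d) If $\mathrm{id}_F$ is homotopic to the zero morphism $F\to F$, then $F$ is homotopic to $\{0\}$. (e) If $F$ is homotopic to $\{0\}$, then $K_0(F)=\{0\}$. -/

import Mathlib

noncomputable section

namespace ProjK

universe u v w

/-! ## `E`-C*-algebras and homotopies -/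

/-- An `E`-C*-algebra over a commutative unital C*-algebra `E`: a C*-algebra `F` with a bilinear
exterior multiplication `E × F → F` such that `(αβ)x = α(βx)`, `1x = x`, `α(xy) = (αx)y = x(αy)`,
`(αx)* = α*x*` and `‖αx‖ ≤ ‖α‖‖x‖`.  Complex linearity in `α` is `IsScalarTower ℂ E F`; complex
linearity in `x` then follows, as `E` is commutative. -/
class ECStarAlgebra (E : Type u) (F : Type v) [CommCStarAlgebra E] [NonUnitalCStarAlgebra F]
    extends Module E F where
  complex_smul : ∀ (c : ℂ) (α : E) (x : F), (c • α) • x = c • (α • x)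
  smul_mul : ∀ (α : E) (x y : F), α • (x * y) = (α • x) * y
  mul_smul_right : ∀ (α : E) (x y : F), α • (x * y) = x * (α • y)
  star_smul_smul : ∀ (α : E) (x : F), star (α • x) = star α • star x
  norm_smul_le_mul : ∀ (α : E) (x : F), ‖α • x‖ ≤ ‖α‖ * ‖x‖

section ECStar

variable {E : Type u} {F : Type v} {G : Type w} [CommCStarAlgebra E]
  [NonUnitalCStarAlgebra F] [ECStarAlgebra E F] [NonUnitalCStarAlgebra G] [ECStarAlgebra E G]

instance : IsScalarTower ℂ E F := ⟨ECStarAlgebra.complex_smul⟩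
instance : IsScalarTower E F F := ⟨fun α x y => (ECStarAlgebra.smul_mul α x y).symm⟩
instance : SMulCommClass E F F := ⟨fun α x y => ECStarAlgebra.mul_smul_right α x y⟩
instance : StarModule E F := ⟨ECStarAlgebra.star_smul_smul⟩

/-- Morphisms of `E`-C*-algebras are the `E`-linear *-homomorphisms `F →⋆ₙₐ[E] G` (not necessarily
unital).  Two of them are homotopic if they are joined by a pointwise continuous path of such
morphisms, parametrized by `[0,1]`. -/
def Homotopic (φ ψ : F →⋆ₙₐ[E] G) : Prop :=
  ∃ Φ : unitInterval → (F →⋆ₙₐ[E] G),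
    Φ 0 = φ ∧ Φ 1 = ψ ∧ ∀ x : F, Continuous fun s => Φ s x

/-- The pair `φ : F → G`, `ψ : G → F` is a homotopy: `ψ ∘ φ` is homotopic to the identity of `F` and
`φ ∘ ψ` is homotopic to the identity of `G`. -/
def IsHomotopy (φ : F →⋆ₙₐ[E] G) (ψ : G →⋆ₙₐ[E] F) : Prop :=
  Homotopic (ψ.comp φ) (NonUnitalStarAlgHom.id E F) ∧
    Homotopic (φ.comp ψ) (NonUnitalStarAlgHom.id E G)

variable (E F G) in
/-- `F` and `G` are homotopic `E`-C*-algebras. -/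
def HomotopicAlgebras : Prop :=
  ∃ (φ : F →⋆ₙₐ[E] G) (ψ : G →⋆ₙₐ[E] F), IsHomotopy φ ψ

end ECStar

/-! ### The zero `E`-C*-algebra -/

instance : Star PUnit.{v + 1} := ⟨fun x => x⟩

instance : NonUnitalCStarAlgebra PUnit.{v + 1} where
  star_involutive _ := rfl
  star_mul _ _ := rfl
  star_add _ _ := rfl
  complete := fun {f} hf => ⟨PUnit.unit, fun s hs => by
    exact Filter.mem_of_superset Filter.univ_mem (fun x _ => mem_of_mem_nhds hs)⟩
  norm_mul_self_le _ := by simp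
  norm_smul_le _ _ := by simp
  smul_assoc _ _ _ := rfl
  smul_comm _ _ _ := rfl
  star_smul _ _ := rfl

instance (E : Type u) [CommCStarAlgebra E] : ECStarAlgebra E PUnit.{v + 1} where
  complex_smul _ _ _ := rfl
  smul_mul _ _ _ := rfl
  mul_smul_right _ _ _ := rfl
  star_smul_smul _ _ := rfl
  norm_smul_le_mul _ _ := by simp

/-! ## Schur functions and the algebras `F_n` -/

/-- A group `Γ` that is the union of an increasing sequence `T 0 = {1} ⊆ T 1 ⊆ T 2 ⊆ …` of finite
subgroups, together with a Schur `E`-function (normalized unitary `2`-cocycle) `f` on `Γ`. -/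
structure SchurSystem (E : Type u) (Γ : Type v) [CommRing E] [StarRing E] [Group Γ] where
  T : ℕ → Subgroup Γ
  T_zero : T 0 = ⊥
  T_mono : Monotone T
  T_finite : ∀ n, Finite (T n)
  T_exhaust : ∀ t, ∃ n, t ∈ T n
  f : Γ → Γ → unitary E
  f_one_one : f 1 1 = 1
  f_cocycle : ∀ r s t, f r s * f (r * s) t = f r (s * t) * f s t

namespace SchurSystem

section

variable {E : Type u} {Γ : Type v} [CommRing E] [StarRing E] [Group Γ] (S : SchurSystem E Γ)
variable (R : Type w) [Ring R] [StarRing R] [Algebra E R] [StarModule E R]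

instance (n : ℕ) : Fintype (S.T n) :=
  haveI := S.T_finite n
  Fintype.ofFinite _

instance (n : ℕ) : DecidableEq (S.T n) := Classical.decEq _

theorem f_right_one (t : Γ) : S.f t 1 = 1 := by
  have h := S.f_cocycle t 1 1
  simp only [mul_one, S.f_one_one] at h
  simpa using h

theorem f_left_one (t : Γ) : S.f 1 t = 1 := by
  have h := S.f_cocycle 1 1 t
  simp only [one_mul, S.f_one_one] at h
  simpa using h

/-- The operator `V_t` on `R^{T n}`, `(V_t ξ)(s) = f(t, t⁻¹s) ξ(t⁻¹s)`, as a matrix acting on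
column vectors from the left. Matrices over `R` indexed by `T n` are exactly the adjointable
operators of the Hilbert right `R`-module `R^{T n}`, and the adjoint is the conjugate transpose. -/
def V (n : ℕ) (t : S.T n) : Matrix (S.T n) (S.T n) R :=
  Matrix.of fun s r => if r = t⁻¹ * s then algebraMap E R (S.f t (t⁻¹ * s)) else 0

/-- `∑_{t ∈ T n} (X_t ⊗ id) V_t`, where `x ⊗ id` is left multiplication of all coordinates
by `x`. -/
def combo (n : ℕ) (X : S.T n → R) : Matrix (S.T n) (S.T n) R :=
  ∑ t, Matrix.scalar (S.T n) (X t) * S.V R n t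

theorem combo_apply (n : ℕ) (X : S.T n → R) (s r : S.T n) :
    S.combo R n X s r = (S.f (s * r⁻¹ : S.T n) r : E) • X (s * r⁻¹) := by
  unfold combo
  rw [Matrix.sum_apply, Finset.sum_eq_single (s * r⁻¹)]
  · simp [V, Matrix.scalar_apply, Matrix.diagonal_mul, Algebra.smul_def, Algebra.commutes]
  · intro t _ ht
    have : r ≠ t⁻¹ * s := by
      rintro rfl
      apply ht
      group
    simp [V, Matrix.scalar_apply, Matrix.diagonal_mul, this]
  · simp

theorem combo_apply_one (n : ℕ) (X : S.T n → R) (t : S.T n) : S.combo R n X t 1 = X t := by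
  rw [combo_apply]
  simp [f_right_one]

theorem mem_range_combo {n : ℕ} {M : Matrix (S.T n) (S.T n) R} :
    M ∈ Set.range (S.combo R n) ↔
      ∀ s r, M s r = (S.f (s * r⁻¹ : S.T n) r : E) • M (s * r⁻¹) 1 := by
  constructor
  · rintro ⟨X, rfl⟩ s r
    rw [combo_apply, combo_apply_one]
  · intro h
    refine ⟨fun t => M t 1, ?_⟩
    ext s r
    rw [combo_apply, h s r]

theorem f_cocycle' (a b c : Γ) :
    (S.f a b : E) * S.f (a * b) c = S.f a (b * c) * S.f b c := by
  have := congrArg (Subtype.val) (S.f_cocycle a b c)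
  simpa using this

/-- The algebra `R_n = {∑_{t ∈ T n} (X_t ⊗ id) V_t}` of operators on `R^{T n}`. -/
def alg (n : ℕ) : StarSubalgebra E (Matrix (S.T n) (S.T n) R) where
  carrier := Set.range (S.combo R n)
  add_mem' := by
    intro M N hM hN
    rw [mem_range_combo] at *
    intro s r
    simp only [Matrix.add_apply, smul_add]
    rw [hM s r, hN s r]
  mul_mem' := by
    intro M N hM hN
    rw [mem_range_combo] at *
    intro s r
    rw [Matrix.mul_apply, Matrix.mul_apply, Finset.smul_sum]
    refine (Fintype.sum_equiv (Equiv.mulRight r⁻¹) _ _ ?_)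
    intro q
    simp only [Equiv.coe_mulRight]
    rw [hM s q, hN q r, hM (s * r⁻¹) (q * r⁻¹)]
    have e : s * r⁻¹ * (q * r⁻¹)⁻¹ = s * q⁻¹ := by group
    rw [e, smul_mul_smul_comm, smul_mul_assoc, smul_smul]
    congr 1
    have := S.f_cocycle' (s * q⁻¹ : S.T n) (q * r⁻¹ : S.T n) r
    have e1 : ((s * q⁻¹ : S.T n) : Γ) * ((q * r⁻¹ : S.T n) : Γ) = ((s * r⁻¹ : S.T n) : Γ) := by
      simp
    have e2 : ((q * r⁻¹ : S.T n) : Γ) * (r : Γ) = q := by simp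
    rw [e1, e2] at this
    rw [← this, mul_comm]
  algebraMap_mem' := by
    intro a
    rw [mem_range_combo]
    intro s r
    simp only [Matrix.algebraMap_matrix_apply]
    by_cases h : s = r
    · subst h
      simp [f_left_one]
    · have : s * r⁻¹ ≠ 1 := fun h' => h (mul_inv_eq_one.mp h')
      simp [h, this]
  star_mem' := by
    intro M hM
    rw [mem_range_combo] at *
    intro s r
    simp only [Matrix.star_apply]
    rw [hM r s, hM 1 (s * r⁻¹)]
    have e : (1 : S.T n) * (s * r⁻¹)⁻¹ = r * s⁻¹ := by group
    rw [e, star_smul, star_smul, smul_smul]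
    congr 1
    have := S.f_cocycle' (r * s⁻¹ : S.T n) (s * r⁻¹ : S.T n) r
    have e1 : ((r * s⁻¹ : S.T n) : Γ) * ((s * r⁻¹ : S.T n) : Γ) = 1 := by simp
    have e2 : ((s * r⁻¹ : S.T n) : Γ) * (r : Γ) = s := by simp
    rw [e1, e2, f_left_one] at this
    simp only [OneMemClass.coe_one, mul_one] at this
    have h1 : star (S.f (r * s⁻¹ : S.T n) s : E) * S.f (r * s⁻¹ : S.T n) s = 1 :=
      Unitary.star_mul_self_of_mem (Subtype.property _)
    rw [this, star_mul]
    calc star (S.f (r * s⁻¹ : S.T n) s : E)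
        = ((star (S.f (s * r⁻¹ : S.T n) r : E)) * (S.f (s * r⁻¹ : S.T n) r : E)) *
            star (S.f (r * s⁻¹ : S.T n) s : E) := by
          rw [Unitary.star_mul_self_of_mem (Subtype.property _), one_mul]
      _ = _ := by ring

theorem mem_alg {n : ℕ} {M : Matrix (S.T n) (S.T n) R} :
    M ∈ S.alg R n ↔ M ∈ Set.range (S.combo R n) := Iff.rfl

variable {R}

theorem alg_apply {n : ℕ} (M : S.alg R n) (s r : S.T n) :
    M.1 s r = (S.f (s * r⁻¹ : S.T n) r : E) • M.1 (s * r⁻¹) 1 :=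
  (S.mem_range_combo R).1 M.2 s r

/-- The coefficient family `(X_t)` of `∑ (X_t ⊗ id) V_t`. -/
def coeff {n : ℕ} (M : S.alg R n) (t : S.T n) : R := M.1 t 1

theorem combo_coeff {n : ℕ} (M : S.alg R n) : S.combo R n (S.coeff M) = M.1 := by
  ext s r
  rw [combo_apply, S.alg_apply M s r]
  rfl

theorem alg_ext {n : ℕ} {M N : S.alg R n} (h : ∀ t, S.coeff M t = S.coeff N t) : M = N := by
  apply Subtype.ext
  rw [← S.combo_coeff M, ← S.combo_coeff N, funext h]

/-- The element `∑_{t ∈ T n} (X_t ⊗ id) V_t` of `R_n`. -/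
def ofCoeff (n : ℕ) (X : S.T n → R) : S.alg R n :=
  ⟨S.combo R n X, (S.mem_alg R).2 ⟨X, rfl⟩⟩

theorem coeff_ofCoeff (n : ℕ) (X : S.T n → R) (t : S.T n) :
    S.coeff (S.ofCoeff n X) t = X t :=
  S.combo_apply_one R n X t

theorem coeff_zero {n : ℕ} (t : S.T n) : S.coeff (0 : S.alg R n) t = 0 := rfl

theorem coeff_add {n : ℕ} (M N : S.alg R n) (t : S.T n) :
    S.coeff (M + N) t = S.coeff M t + S.coeff N t := rfl

theorem coeff_mul {n : ℕ} (M N : S.alg R n) (u : S.T n) :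
    S.coeff (M * N) u = ∑ q, ((S.f (u * q⁻¹ : S.T n) q : E) • S.coeff M (u * q⁻¹)) *
      S.coeff N q := by
  change (M.1 * N.1) u 1 = _
  rw [Matrix.mul_apply]
  refine Finset.sum_congr rfl fun q _ => ?_
  rw [S.alg_apply M u q]
  rfl

theorem coeff_mul' {n : ℕ} (M N : S.alg R n) (u : S.T n) :
    S.coeff (M * N) u = ∑ p : S.T n, ((S.f p (p⁻¹ * u : S.T n) : E) • S.coeff M p) *
      S.coeff N (p⁻¹ * u) := by
  rw [coeff_mul]
  refine Fintype.sum_equiv ((Equiv.inv _).trans (Equiv.mulLeft u)) _ _ fun q => ?_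
  have e : (u * q⁻¹)⁻¹ * u = q := by group
  simp only [Equiv.trans_apply, Equiv.inv_apply, Equiv.coe_mulLeft, e]

theorem coeff_star {n : ℕ} (M : S.alg R n) (u : S.T n) :
    S.coeff (star M) u = star ((S.f (u⁻¹ : S.T n) u : E) • S.coeff M u⁻¹) := by
  change star (M.1 1 u) = _
  rw [S.alg_apply M 1 u]
  simp [coeff]

/-- The family `(X_t)_{t ∈ T m}` extended by zero to `T n`. -/
def extend (m n : ℕ) (X : S.T m → R) (t : S.T n) : R :=
  haveI := Classical.dec ((t : Γ) ∈ S.T m)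
  if h : (t : Γ) ∈ S.T m then X ⟨t, h⟩ else 0

theorem extend_of_mem {m n : ℕ} (X : S.T m → R) (t : S.T n) (h : (t : Γ) ∈ S.T m) :
    S.extend m n X t = X ⟨t, h⟩ := by
  simp [extend, h]

theorem extend_of_notMem {m n : ℕ} (X : S.T m → R) (t : S.T n) (h : (t : Γ) ∉ S.T m) :
    S.extend m n X t = 0 := by
  simp [extend, h]

/-- The inclusion `R_m ⊆ R_n`, `m ≤ n`: it sends `∑_{t ∈ T m} (X_t ⊗ id) V_t` to the same sum
in `R_n`. -/
def incl {m n : ℕ} (h : m ≤ n) : S.alg R m →⋆ₙ+* S.alg R n where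
  toFun M := S.ofCoeff n (S.extend m n (S.coeff M))
  map_zero' := by
    apply S.alg_ext
    intro t
    rw [coeff_ofCoeff]
    by_cases ht : (t : Γ) ∈ S.T m
    · rw [extend_of_mem _ _ _ ht, coeff_zero, coeff_zero]
    · rw [extend_of_notMem _ _ _ ht, coeff_zero]
  map_add' M N := by
    apply S.alg_ext
    intro t
    rw [coeff_ofCoeff]
    rw [coeff_add, coeff_ofCoeff, coeff_ofCoeff]
    by_cases ht : (t : Γ) ∈ S.T m
    · simp only [extend_of_mem _ _ _ ht, coeff_add]
    · simp only [extend_of_notMem _ _ _ ht, add_zero]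
  map_mul' M N := by
    apply S.alg_ext
    intro u
    rw [coeff_ofCoeff, coeff_mul]
    simp only [coeff_ofCoeff]
    by_cases hu : (u : Γ) ∈ S.T m
    · rw [extend_of_mem _ _ _ hu, coeff_mul]
      refine Fintype.sum_of_injective (Subgroup.inclusion (S.T_mono h))
        (Subgroup.inclusion_injective _) _ _ ?_ ?_
      · intro q hq
        have : (q : Γ) ∉ S.T m := fun hq' => hq ⟨⟨q, hq'⟩, rfl⟩
        rw [extend_of_notMem _ (S.coeff N) q this, mul_zero]
      · intro q
        have h1 : ((Subgroup.inclusion (S.T_mono h) q : S.T n) : Γ) ∈ S.T m := q.2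
        have h2 : ((u * (Subgroup.inclusion (S.T_mono h) q)⁻¹ : S.T n) : Γ) ∈ S.T m :=
          mul_mem hu (inv_mem h1)
        rw [extend_of_mem _ _ _ h1, extend_of_mem _ _ _ h2]
        rfl
    · rw [extend_of_notMem _ _ _ hu]
      symm
      apply Finset.sum_eq_zero
      intro q _
      by_cases hq : (q : Γ) ∈ S.T m
      · have : ((u * q⁻¹ : S.T n) : Γ) ∉ S.T m := by
          intro h'
          apply hu
          have := mul_mem h' hq
          simpa using this
        rw [extend_of_notMem _ _ _ this, smul_zero, zero_mul]
      · rw [extend_of_notMem _ (S.coeff N) q hq, mul_zero]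
  map_star' M := by
    apply S.alg_ext
    intro u
    rw [coeff_ofCoeff, coeff_star, coeff_ofCoeff]
    by_cases hu : (u : Γ) ∈ S.T m
    · have h2 : ((u⁻¹ : S.T n) : Γ) ∈ S.T m := inv_mem hu
      rw [extend_of_mem _ _ _ hu, extend_of_mem _ _ _ h2, coeff_star]
      rfl
    · have h2 : ((u⁻¹ : S.T n) : Γ) ∉ S.T m := fun h' => hu (by simpa using inv_mem h')
      rw [extend_of_notMem _ _ _ hu, extend_of_notMem _ _ _ h2]
      simp

theorem coeff_incl {m n : ℕ} (h : m ≤ n) (M : S.alg R m) (t : S.T n) :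
    S.coeff (S.incl h M) t = S.extend m n (S.coeff M) t :=
  S.coeff_ofCoeff _ _ t

variable {R₁ : Type*} [Ring R₁] [StarRing R₁] [Algebra E R₁] [StarModule E R₁]
variable {R₂ : Type*} [Ring R₂] [StarRing R₂] [Algebra E R₂] [StarModule E R₂]

theorem map_combo (n : ℕ) (φ : R →⋆ₐ[E] R₁) (X : S.T n → R) :
    (S.combo R n X).map φ = S.combo R₁ n fun t => φ (X t) := by
  ext s r
  simp only [Matrix.map_apply, combo_apply]
  rw [map_smul]

/-- The unital *-homomorphism `φ_n : R_n → R₁_n`, `∑ (X_t ⊗ id) V_t ↦ ∑ (φ(X_t) ⊗ id) V_t`. -/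
def algMap (n : ℕ) (φ : R →⋆ₐ[E] R₁) : S.alg R n →⋆ₐ[E] S.alg R₁ n where
  toFun M := ⟨M.1.map φ, by
    obtain ⟨X, hX⟩ := (S.mem_alg R).1 M.2
    exact (S.mem_alg R₁).2 ⟨fun t => φ (X t), by rw [← hX, map_combo]⟩⟩
  map_one' := by
    apply Subtype.ext
    exact Matrix.map_one φ (map_zero φ) (map_one φ)
  map_mul' M N := by
    apply Subtype.ext
    exact Matrix.map_mul (f := (φ : R →+* R₁))
  map_zero' := by
    apply Subtype.ext
    exact Matrix.map_zero φ (map_zero φ)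
  map_add' M N := by
    apply Subtype.ext
    exact Matrix.map_add φ (map_add φ) M.1 N.1
  commutes' a := by
    apply Subtype.ext
    exact Matrix.map_algebraMap a φ (map_zero φ) (AlgHomClass.commutes φ a)
  map_star' M := by
    apply Subtype.ext
    ext s r
    exact map_star φ _

theorem coeff_algMap {n : ℕ} (φ : R →⋆ₐ[E] R₁) (M : S.alg R n) (t : S.T n) :
    S.coeff (S.algMap n φ M) t = φ (S.coeff M t) := rfl

theorem algMap_incl {m n : ℕ} (h : m ≤ n) (φ : R →⋆ₐ[E] R₁) (M : S.alg R m) :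
    S.algMap n φ (S.incl h M) = S.incl h (S.algMap m φ M) := by
  apply S.alg_ext
  intro t
  rw [coeff_algMap, coeff_incl, coeff_incl]
  by_cases ht : (t : Γ) ∈ S.T m
  · rw [extend_of_mem _ _ _ ht, extend_of_mem _ _ _ ht, coeff_algMap]
  · rw [extend_of_notMem _ _ _ ht, extend_of_notMem _ _ _ ht, map_zero]

end

end SchurSystem

/-! ## The inductive limit `F_→` -/

section

variable (E : Type u) (Γ : Type v) [CommRing E] [StarRing E] [Group Γ]

variable {E Γ} in
/-- The standing condition on elements `C n ∈ E_{n+1}`, `n : ℕ`: each commutes with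
`E_n ⊆ E_{n+1}`, and `A = C*C` and `B = CC*` are projections with `A + B = 1`. -/
structure SchurSystem.IsAdmissible (S : SchurSystem E Γ) (C : ∀ n : ℕ, S.alg E (n + 1)) :
    Prop where
  isStarProjection_A : ∀ n, IsStarProjection (star (C n) * C n)
  isStarProjection_B : ∀ n, IsStarProjection (C n * star (C n))
  A_add_B : ∀ n, star (C n) * C n + C n * star (C n) = 1
  commute_C : ∀ (n : ℕ) (X : S.alg E n), Commute (C n) (S.incl (Nat.le_succ n) X)

/-- The standing data of projective K-theory: a Schur system together with an admissible sequence
`C n ∈ E_{n+1}`, `n : ℕ`. -/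
structure Datum extends SchurSystem E Γ where
  C : ∀ n : ℕ, toSchurSystem.alg E (n + 1)
  isAdmissible : toSchurSystem.IsAdmissible C

end

namespace Datum

variable {E : Type u} {Γ : Type v} [CommRing E] [StarRing E] [Group Γ] (D : Datum E Γ)
variable (R : Type w) [Ring R] [StarRing R] [Algebra E R] [StarModule E R]

/-- The image of `C n ∈ E_{n+1}` in `R_{n+1}`. -/
def c (n : ℕ) : D.alg R (n + 1) := D.algMap (n + 1) (StarAlgHom.ofId E R) (D.C n)

/-- The projection `A = C*C` in `R_{n+1}`. -/
def a (n : ℕ) : D.alg R (n + 1) := star (D.c R n) * D.c R n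

/-- The projection `B = CC*` in `R_{n+1}`. -/
def b (n : ℕ) : D.alg R (n + 1) := D.c R n * star (D.c R n)

theorem a_eq (n : ℕ) :
    D.a R n = D.algMap (n + 1) (StarAlgHom.ofId E R) (star (D.C n) * D.C n) := by
  rw [a, c, map_mul, map_star]

theorem b_eq (n : ℕ) :
    D.b R n = D.algMap (n + 1) (StarAlgHom.ofId E R) (D.C n * star (D.C n)) := by
  rw [b, c, map_mul, map_star]

theorem isStarProjection_a (n : ℕ) : IsStarProjection (D.a R n) := by
  rw [a_eq]
  exact (D.isAdmissible.isStarProjection_A n).map _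

theorem isStarProjection_b (n : ℕ) : IsStarProjection (D.b R n) := by
  rw [b_eq]
  exact (D.isAdmissible.isStarProjection_B n).map _

theorem a_add_b (n : ℕ) : D.a R n + D.b R n = 1 := by
  rw [a_eq, b_eq, ← map_add, D.isAdmissible.A_add_B, map_one]

theorem a_mul_b (n : ℕ) : D.a R n * D.b R n = 0 := by
  have h : D.b R n = 1 - D.a R n := by
    rw [← D.a_add_b R n, add_sub_cancel_left]
  rw [h, mul_sub, mul_one, (D.isStarProjection_a R n).isIdempotentElem.eq, sub_self]

theorem commute_c (n : ℕ) (X : D.alg R n) :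
    Commute (D.c R n) (D.incl (Nat.le_succ n) X) := by
  have key : ∀ (q u : D.T (n + 1)), (q : Γ) ∈ D.T n →
      (D.f (u * q⁻¹ : D.T (n + 1)) q : E) * D.coeff (D.C n) (u * q⁻¹) =
        D.f q (q⁻¹ * u : D.T (n + 1)) * D.coeff (D.C n) (q⁻¹ * u) := by
    intro q u hq
    have h1 := congrArg (fun M => D.coeff M u)
      (D.isAdmissible.commute_C n (D.ofCoeff n (Pi.single ⟨q, hq⟩ 1))).eq
    have h2 : ∀ p : D.T (n + 1), D.coeff (D.incl (Nat.le_succ n)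
        (D.ofCoeff n (Pi.single ⟨q, hq⟩ (1 : E)))) p = if p = q then 1 else 0 := by
      intro p
      rw [D.coeff_incl]
      by_cases hp : (p : Γ) ∈ D.T n
      · rw [D.extend_of_mem _ _ hp, D.coeff_ofCoeff, Pi.single_apply]
        exact if_congr (by rw [Subtype.ext_iff, Subtype.ext_iff]) rfl rfl
      · have : p ≠ q := fun h => hp (h ▸ hq)
        rw [D.extend_of_notMem _ _ hp, if_neg this]
    change D.coeff (_ * _) u = D.coeff (_ * _) u at h1
    rw [D.coeff_mul, D.coeff_mul'] at h1
    simpa [h2] using h1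
  apply D.alg_ext
  intro u
  rw [D.coeff_mul, D.coeff_mul']
  refine Finset.sum_congr rfl fun q _ => ?_
  rw [D.coeff_incl]
  by_cases hq : (q : Γ) ∈ D.T n
  · have hc : ∀ t, D.coeff (D.c R n) t = algebraMap E R (D.coeff (D.C n) t) := fun t => rfl
    rw [hc, hc, Algebra.smul_def, ← map_mul, key q u hq, map_mul, Algebra.smul_def, mul_assoc,
      mul_assoc, Algebra.commutes (D.coeff (D.C n) (q⁻¹ * u))]
  · rw [D.extend_of_notMem _ _ hq]
    simp

theorem commute_a (n : ℕ) (X : D.alg R n) :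
    Commute (D.a R n) (D.incl (Nat.le_succ n) X) := by
  refine Commute.mul_left ?_ (D.commute_c R n X)
  have h := (D.commute_c R n (star X)).star_star
  rwa [map_star, star_star] at h

/-- The transition map `R_n → R_{n+1}`, `X ↦ A X = X A = A X A = C* X C`. -/
def rhoBar (n : ℕ) : D.alg R n →⋆ₙ+* D.alg R (n + 1) where
  toFun X := D.a R n * D.incl (Nat.le_succ n) X
  map_zero' := by rw [map_zero, mul_zero]
  map_add' X Y := by rw [map_add, mul_add]
  map_mul' X Y := by
    have h := (D.isStarProjection_a R n).isIdempotentElem.eq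
    rw [map_mul]
    calc D.a R n * (D.incl (Nat.le_succ n) X * D.incl (Nat.le_succ n) Y)
        = D.a R n * D.a R n * D.incl (Nat.le_succ n) X * D.incl (Nat.le_succ n) Y := by
          rw [h, mul_assoc]
      _ = D.a R n * (D.a R n * D.incl (Nat.le_succ n) X) * D.incl (Nat.le_succ n) Y := by
          simp only [mul_assoc]
      _ = D.a R n * (D.incl (Nat.le_succ n) X * D.a R n) * D.incl (Nat.le_succ n) Y := by
          rw [(D.commute_a R n X).eq]
      _ = _ := by simp only [mul_assoc]
  map_star' X := by
    rw [map_star, star_mul, (D.isStarProjection_a R n).isSelfAdjoint.star_eq, ← map_star,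
      (D.commute_a R n (star X)).eq]

theorem rhoBar_apply (n : ℕ) (X : D.alg R n) :
    D.rhoBar R n X = D.a R n * D.incl (Nat.le_succ n) X := rfl

/-- The composite transition map `R_m → R_n`, `m ≤ n`. -/
def rho (m n : ℕ) (h : m ≤ n) : D.alg R m →⋆ₙ+* D.alg R n :=
  Nat.leRec (motive := fun n _ => D.alg R m →⋆ₙ+* D.alg R n) (NonUnitalStarRingHom.id _)
    (fun k _ g => (D.rhoBar R k).comp g) h

theorem rho_self (m : ℕ) (X : D.alg R m) : D.rho R m m le_rfl X = X := by
  rw [rho, Nat.leRec_self]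
  rfl

theorem rho_succ (m n : ℕ) (h : m ≤ n) (X : D.alg R m) :
    D.rho R m (n + 1) (Nat.le_succ_of_le h) X = D.rhoBar R n (D.rho R m n h X) := by
  rw [rho, Nat.leRec_succ]
  rfl

instance : DirectedSystem (fun n => D.alg R n) (D.rho R · · ·) where
  map_self _ X := D.rho_self R _ X
  map_map k j i hij hjk X := by
    induction hjk with
    | refl => rw [D.rho_self]
    | step h ih =>
      rw [D.rho_succ R _ _ h, ih, ← D.rho_succ R _ _ (hij.trans h)]

/-- The algebraic inductive limit of the `R_n` along the maps `R_n → R_{n+1}`, an involutive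
algebra, in general without unit. -/
def Lim : Type _ := DirectLimit (fun n => D.alg R n) (D.rho R)

instance : NonUnitalRing (D.Lim R) :=
  inferInstanceAs (NonUnitalRing (DirectLimit (fun n => D.alg R n) (D.rho R)))

instance : StarRing (D.Lim R) :=
  inferInstanceAs (StarRing (DirectLimit (fun n => D.alg R n) (D.rho R)))

variable {R}

/-- The canonical map `R_n → R_→`. -/
def toLim (n : ℕ) : D.alg R n →⋆ₙ+* D.Lim R :=
  DirectLimit.NonUnitalStarRing.of (fun n => D.alg R n) (D.rho R) n

theorem toLim_rho {m n : ℕ} (h : m ≤ n) (X : D.alg R m) :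
    D.toLim n (D.rho R m n h X) = D.toLim m X :=
  DirectLimit.NonUnitalStarRing.of_f (f := D.rho R) h X

theorem toLim_succ (n : ℕ) (X : D.alg R n) :
    D.toLim (n + 1) (D.a R n * D.incl (Nat.le_succ n) X) = D.toLim n X := by
  rw [← rhoBar_apply, ← D.toLim_rho (Nat.le_succ n) X, D.rho_succ R n n le_rfl, D.rho_self]

variable {R₁ : Type*} [Ring R₁] [StarRing R₁] [Algebra E R₁] [StarModule E R₁]
variable {R₂ : Type*} [Ring R₂] [StarRing R₂] [Algebra E R₂] [StarModule E R₂]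

theorem algMap_a (n : ℕ) (φ : R →⋆ₐ[E] R₁) : D.algMap (n + 1) φ (D.a R n) = D.a R₁ n := by
  rw [a_eq, a_eq]
  apply D.alg_ext
  intro t
  exact AlgHomClass.commutes φ _

theorem algMap_rho (φ : R →⋆ₐ[E] R₁) (m n : ℕ) (h : m ≤ n) (X : D.alg R m) :
    D.algMap n φ (D.rho R m n h X) = D.rho R₁ m n h (D.algMap m φ X) := by
  induction h with
  | refl => rw [rho_self, rho_self]
  | step h ih =>
    rw [D.rho_succ R _ _ h, D.rho_succ R₁ _ _ h, ← ih, rhoBar_apply, rhoBar_apply, map_mul,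
      algMap_a, D.algMap_incl]

/-- The *-homomorphism `φ_→ : R_→ → R₁_→` induced by the maps `φ_n`. -/
def limMap (φ : R →⋆ₐ[E] R₁) : D.Lim R →⋆ₙ+* D.Lim R₁ :=
  DirectLimit.NonUnitalStarRing.lift (fun n => D.alg R n) (D.rho R) (D.Lim R₁)
    (fun n => (D.toLim n).comp (D.algMap n φ : D.alg R n →⋆ₙ+* D.alg R₁ n))
    (fun i j h X => by
      change D.toLim j (D.algMap j φ (D.rho R i j h X)) = D.toLim i (D.algMap i φ X)
      rw [algMap_rho, toLim_rho])

theorem limMap_toLim (φ : R →⋆ₐ[E] R₁) (n : ℕ) (X : D.alg R n) :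
    D.limMap φ (D.toLim n X) = D.toLim n (D.algMap n φ X) := rfl

theorem limMap_id : D.limMap (StarAlgHom.id E R) = NonUnitalStarRingHom.id _ := by
  apply NonUnitalStarRingHom.ext
  exact DirectLimit.induction _ fun _ _ => rfl

theorem limMap_comp (ψ : R₁ →⋆ₐ[E] R₂) (φ : R →⋆ₐ[E] R₁) :
    D.limMap (ψ.comp φ) = (D.limMap ψ).comp (D.limMap φ) := by
  apply NonUnitalStarRingHom.ext
  exact DirectLimit.induction _ fun _ _ => rfl

end Datum

/-! ## Murray-von Neumann classes of projections and their Grothendieck group -/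

section MvN

variable (L : Type w) [NonUnitalRing L] [StarRing L]

/-- The set `Pr L` of (self-adjoint) projections of an involutive ring. -/
abbrev Proj : Type w := {p : L // IsStarProjection p}

variable {L} in
/-- Murray-von Neumann equivalence: `p ∼₀ q` if `x*x = p` and `xx* = q` for some `x`. -/
def Proj.Rel (p q : Proj L) : Prop := ∃ x : L, star x * x = p.1 ∧ x * star x = q.1

variable {L} in
theorem Proj.Rel.exists_good {p q : Proj L} (h : p.Rel q) :
    ∃ x : L, star x * x = p.1 ∧ x * star x = q.1 ∧ x * p.1 = x ∧ q.1 * x = x := by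
  obtain ⟨x, h1, h2⟩ := h
  have hp := p.2.isIdempotentElem.eq
  have hq := q.2.isIdempotentElem.eq
  have hps := p.2.isSelfAdjoint.star_eq
  refine ⟨x * p.1, ?_, ?_, ?_, ?_⟩
  · rw [star_mul, hps, mul_assoc, ← mul_assoc (star x), h1, hp, hp]
  · rw [star_mul, hps, mul_assoc, ← mul_assoc p.1, hp, ← h1, mul_assoc, h2, ← mul_assoc, h2, hq]
  · rw [mul_assoc, hp]
  · rw [← h2, mul_assoc, ← mul_assoc (star x), h1, hp]

variable {L} in
theorem Proj.Rel.refl (p : Proj L) : p.Rel p :=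
  ⟨p.1, by rw [p.2.isSelfAdjoint.star_eq, p.2.isIdempotentElem.eq],
    by rw [p.2.isSelfAdjoint.star_eq, p.2.isIdempotentElem.eq]⟩

variable {L} in
theorem Proj.Rel.symm {p q : Proj L} (h : p.Rel q) : q.Rel p := by
  obtain ⟨x, h1, h2⟩ := h
  exact ⟨star x, by rw [star_star, h2], by rw [star_star, h1]⟩

variable {L} in
theorem Proj.Rel.trans {p q r : Proj L} (hpq : p.Rel q) (hqr : q.Rel r) : p.Rel r := by
  obtain ⟨x, h1, h2, h3, h4⟩ := hpq.exists_good
  obtain ⟨y, k1, k2, k3, k4⟩ := hqr.exists_good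
  refine ⟨y * x, ?_, ?_⟩
  · rw [star_mul, mul_assoc, ← mul_assoc (star y), k1, h4, h1]
  · rw [star_mul, mul_assoc, ← mul_assoc x, h2, ← mul_assoc, k3, k2]

instance Proj.setoid : Setoid (Proj L) where
  r := Proj.Rel
  iseqv := ⟨Proj.Rel.refl, Proj.Rel.symm, Proj.Rel.trans⟩

/-- Any projection is equivalent to one orthogonal to a given projection. -/
class HasOrthogonal : Prop where
  exists_orth : ∀ p q : Proj L, ∃ q' : Proj L, q.Rel q' ∧ p.1 * q'.1 = 0

variable {L} in
theorem HasOrthogonal.of_exists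
    (H : ∀ p q : L, ∃ x : L, star x * x = star q * q ∧ p * x = 0) : HasOrthogonal L where
  exists_orth p q := by
    obtain ⟨x, hx, hpx⟩ := H p.1 q.1
    have hqq := q.2.isIdempotentElem.eq
    have hqs := q.2.isSelfAdjoint.star_eq
    have hxx : star x * x = q.1 := by rw [hx, hqs, hqq]
    refine ⟨⟨x * q.1 * star x, ⟨?_, ?_⟩⟩, ⟨x * q.1, ?_, ?_⟩, ?_⟩
    · change x * q.1 * star x * (x * q.1 * star x) = _
      calc x * q.1 * star x * (x * q.1 * star x)
          = x * (q.1 * (star x * x) * q.1) * star x := by simp only [mul_assoc]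
        _ = _ := by rw [hxx, hqq, hqq]
    · change star (x * q.1 * star x) = _
      rw [star_mul, star_mul, star_star, hqs, mul_assoc]
    · rw [star_mul, hqs]
      calc q.1 * star x * (x * q.1) = q.1 * (star x * x) * q.1 := by simp only [mul_assoc]
        _ = _ := by rw [hxx, hqq, hqq]
    · change x * q.1 * star (x * q.1) = x * q.1 * star x
      rw [star_mul x, hqs]
      calc x * q.1 * (q.1 * star x) = x * (q.1 * q.1) * star x := by simp only [mul_assoc]
        _ = _ := by rw [hqq]
    · change p.1 * (x * q.1 * star x) = 0
      rw [← mul_assoc, ← mul_assoc, hpx, zero_mul, zero_mul]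

/-- The set `Pr L / ∼₀`. -/
def MvN : Type w := Quotient (Proj.setoid L)

variable {L}

/-- The sum of two orthogonal projections. -/
def Proj.osum (p q : Proj L) (h : p.1 * q.1 = 0) : Proj L := ⟨p.1 + q.1, p.2.add q.2 h⟩

theorem Proj.orth_symm {p q : Proj L} (h : p.1 * q.1 = 0) : q.1 * p.1 = 0 := by
  have := congrArg star h
  rwa [star_mul, star_zero, p.2.isSelfAdjoint.star_eq, q.2.isSelfAdjoint.star_eq] at this

theorem Proj.Rel.osum {p p' q q' : Proj L} (hp : p.Rel p') (hq : q.Rel q')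
    (h : p.1 * q.1 = 0) (h' : p'.1 * q'.1 = 0) : (p.osum q h).Rel (p'.osum q' h') := by
  obtain ⟨x, h1, h2, h3, h4⟩ := hp.exists_good
  obtain ⟨y, k1, k2, k3, k4⟩ := hq.exists_good
  have e1 : x * star y = 0 := by
    rw [← h3, ← k3, star_mul, q.2.isSelfAdjoint.star_eq, mul_assoc, ← mul_assoc p.1, h, zero_mul,
      mul_zero]
  have e2 : star x * y = 0 := by
    rw [← h4, ← k4, star_mul, p'.2.isSelfAdjoint.star_eq, mul_assoc, ← mul_assoc p'.1, h',
      zero_mul, mul_zero]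
  have e3 : y * star x = 0 := by simpa using congrArg star e1
  have e4 : star y * x = 0 := by simpa using congrArg star e2
  refine ⟨x + y, ?_, ?_⟩
  · simp only [star_add, add_mul, mul_add, e2, e4, h1, k1, Proj.osum]
    simp
  · simp only [star_add, add_mul, mul_add, e1, e3, h2, k2, Proj.osum]
    simp

namespace MvN

/-- The class of a projection. -/
def mk (p : Proj L) : MvN L := Quotient.mk _ p

theorem mk_eq {p q : Proj L} (h : p.Rel q) : mk p = mk q := Quotient.sound h

variable [HasOrthogonal L]

/-- `[p] + [q]` is the class of `p + q'`, where `q' ∼₀ q` is any projection orthogonal to `p`;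
`mk_add_mk` shows that the sum of any two orthogonal representatives may be used. -/
instance : Add (MvN L) where
  add := Quotient.lift₂
    (fun p q => mk (p.osum _ (HasOrthogonal.exists_orth p q).choose_spec.2))
    (fun p q p' q' (hp : p.Rel p') (hq : q.Rel q') => mk_eq (Proj.Rel.osum hp
      ((HasOrthogonal.exists_orth p q).choose_spec.1.symm.trans
        (hq.trans (HasOrthogonal.exists_orth p' q').choose_spec.1)) _ _))

theorem mk_add_mk (p q : Proj L) (h : p.1 * q.1 = 0) : mk p + mk q = mk (p.osum q h) :=
  mk_eq (Proj.Rel.osum (Proj.Rel.refl p) (HasOrthogonal.exists_orth p q).choose_spec.1.symm _ _)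

variable (L) in
/-- The zero projection. -/
def zeroProj : Proj L := ⟨0, IsStarProjection.zero L⟩

instance : Zero (MvN L) := ⟨mk (zeroProj L)⟩

theorem exists_orth_rep (p : Proj L) (b : MvN L) : ∃ q : Proj L, b = mk q ∧ p.1 * q.1 = 0 := by
  obtain ⟨q, rfl⟩ : ∃ q, mk q = b := Quotient.exists_rep b
  obtain ⟨q', h, hq⟩ := HasOrthogonal.exists_orth p q
  exact ⟨q', mk_eq h, hq⟩

/-- `Pr L / ∼₀` is an abelian monoid under `⊕`, with neutral element the class of `0`. -/
instance : AddCommMonoid (MvN L) where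
  add_assoc a b c := by
    obtain ⟨p, rfl⟩ : ∃ p, mk p = a := Quotient.exists_rep a
    obtain ⟨q, rfl, hpq⟩ := exists_orth_rep p b
    obtain ⟨r, rfl, hr⟩ := exists_orth_rep (p.osum q hpq) c
    have hr' : (p.1 + q.1) * r.1 = 0 := hr
    have hqp := Proj.orth_symm hpq
    have hpr : p.1 * r.1 = 0 := by
      have : p.1 * ((p.1 + q.1) * r.1) = p.1 * r.1 := by
        rw [← mul_assoc, mul_add, p.2.isIdempotentElem.eq, hpq, add_zero]
      rw [← this, hr', mul_zero]
    have hqr : q.1 * r.1 = 0 := by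
      rwa [add_mul, hpr, zero_add] at hr'
    have hpqr : p.1 * (q.osum r hqr).1 = 0 := by
      change p.1 * (q.1 + r.1) = 0
      rw [mul_add, hpq, hpr, add_zero]
    rw [mk_add_mk p q hpq, mk_add_mk _ _ hr, mk_add_mk q r hqr, mk_add_mk _ _ hpqr]
    congr 1
    exact Subtype.ext (add_assoc _ _ _)
  zero_add a := by
    obtain ⟨p, rfl⟩ : ∃ p, mk p = a := Quotient.exists_rep a
    change mk (zeroProj L) + mk p = _
    rw [mk_add_mk _ p (zero_mul _)]
    congr 1
    exact Subtype.ext (zero_add _)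
  add_zero a := by
    obtain ⟨p, rfl⟩ : ∃ p, mk p = a := Quotient.exists_rep a
    change mk p + mk (zeroProj L) = _
    rw [mk_add_mk p _ (mul_zero _)]
    congr 1
    exact Subtype.ext (add_zero _)
  add_comm a b := by
    obtain ⟨p, rfl⟩ : ∃ p, mk p = a := Quotient.exists_rep a
    obtain ⟨q, rfl, hpq⟩ := exists_orth_rep p b
    rw [mk_add_mk p q hpq, mk_add_mk q p (Proj.orth_symm hpq)]
    congr 1
    exact Subtype.ext (add_comm _ _)
  nsmul := nsmulRec

end MvN

variable {L₁ : Type*} [NonUnitalRing L₁] [StarRing L₁]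
variable {L₂ : Type*} [NonUnitalRing L₂] [StarRing L₂]

/-- The image of a projection under a *-homomorphism. -/
def Proj.map (g : L →⋆ₙ+* L₁) (p : Proj L) : Proj L₁ := ⟨g p.1, p.2.map g⟩

theorem Proj.Rel.map (g : L →⋆ₙ+* L₁) {p q : Proj L} (h : p.Rel q) :
    (p.map g).Rel (q.map g) := by
  obtain ⟨x, h1, h2⟩ := h
  exact ⟨g x, by rw [← map_star, ← map_mul, h1]; rfl, by rw [← map_star, ← map_mul, h2]; rfl⟩

variable [HasOrthogonal L] [HasOrthogonal L₁] [HasOrthogonal L₂]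

/-- The additive map `[p] ↦ [g p]` induced by a *-homomorphism `g`. -/
def MvN.map (g : L →⋆ₙ+* L₁) : MvN L →+ MvN L₁ where
  toFun := Quotient.lift (fun p => MvN.mk (p.map g)) fun _ _ h => MvN.mk_eq (Proj.Rel.map g h)
  map_zero' := congrArg MvN.mk (Subtype.ext (map_zero g))
  map_add' a b := by
    obtain ⟨p, rfl⟩ : ∃ p, MvN.mk p = a := Quotient.exists_rep a
    obtain ⟨q, rfl, hpq⟩ := MvN.exists_orth_rep p b
    rw [MvN.mk_add_mk p q hpq]
    have h : (p.map g).1 * (q.map g).1 = 0 := by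
      change g p.1 * g q.1 = 0
      rw [← map_mul, hpq, map_zero]
    change MvN.mk _ = MvN.mk (p.map g) + MvN.mk (q.map g)
    rw [MvN.mk_add_mk _ _ h]
    congr 1
    exact Subtype.ext (map_add g _ _)

theorem MvN.map_mk (g : L →⋆ₙ+* L₁) (p : Proj L) :
    MvN.map g (MvN.mk p) = MvN.mk (p.map g) := rfl

theorem MvN.map_comp (g' : L₁ →⋆ₙ+* L₂) (g : L →⋆ₙ+* L₁) :
    MvN.map (g'.comp g) = (MvN.map g').comp (MvN.map g) := by
  apply AddMonoidHom.ext
  intro a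
  obtain ⟨p, rfl⟩ : ∃ p, MvN.mk p = a := Quotient.exists_rep a
  rfl

theorem MvN.map_id : MvN.map (NonUnitalStarRingHom.id L) = AddMonoidHom.id _ := by
  apply AddMonoidHom.ext
  intro a
  obtain ⟨p, rfl⟩ : ∃ p, MvN.mk p = a := Quotient.exists_rep a
  rfl

end MvN

/-! ## The group `K₀` -/

namespace Datum

section

variable {E : Type u} {Γ : Type v} [CommRing E] [StarRing E] [Group Γ] (D : Datum E Γ)
variable (R : Type w) [Ring R] [StarRing R] [Algebra E R] [StarModule E R]
variable {R₁ : Type*} [Ring R₁] [StarRing R₁] [Algebra E R₁] [StarModule E R₁]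
variable {R₂ : Type*} [Ring R₂] [StarRing R₂] [Algebra E R₂] [StarModule E R₂]

theorem exists_isometry (n : ℕ) :
    ∃ d : D.alg R (n + 1), star d * d = D.a R n ∧ D.a R n * d = 0 := by
  have haa := (D.isStarProjection_a R n).isIdempotentElem.eq
  have has := (D.isStarProjection_a R n).isSelfAdjoint.star_eq
  have hbb := (D.isStarProjection_b R n).isIdempotentElem.eq
  have hbs := (D.isStarProjection_b R n).isSelfAdjoint.star_eq
  have hcc : star (D.c R n) * D.c R n = D.a R n := rfl
  have hcb : D.c R n * star (D.c R n) = D.b R n := rfl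
  refine ⟨D.b R n * D.c R n * D.a R n, ?_, ?_⟩
  · calc star (D.b R n * D.c R n * D.a R n) * (D.b R n * D.c R n * D.a R n)
        = D.a R n * (star (D.c R n) * (D.b R n * D.b R n) * D.c R n) * D.a R n := by
          rw [star_mul, star_mul, has, hbs]; simp only [mul_assoc]
      _ = D.a R n * ((star (D.c R n) * D.c R n) * (star (D.c R n) * D.c R n)) * D.a R n := by
          rw [hbb, ← hcb]; simp only [mul_assoc]
      _ = D.a R n := by rw [hcc, haa, haa, haa]
  · rw [← mul_assoc, ← mul_assoc, a_mul_b, zero_mul, zero_mul]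

theorem toLim_isometry (n : ℕ) (d : D.alg R (n + 1)) (h : star d * d = D.a R n)
    (Y : D.alg R n) :
    star (D.toLim (n + 1) (d * D.incl (Nat.le_succ n) Y)) *
      D.toLim (n + 1) (d * D.incl (Nat.le_succ n) Y) = D.toLim n (star Y * Y) := by
  rw [← map_star, ← map_mul, ← D.toLim_succ n (star Y * Y)]
  congr 1
  have h1 := (D.commute_a R n (star Y)).eq
  rw [star_mul, ← map_star, map_mul, mul_assoc, ← mul_assoc (star d), h, ← mul_assoc, ← h1,
    mul_assoc]

theorem toLim_orth (n : ℕ) (d : D.alg R (n + 1)) (h : D.a R n * d = 0) (X Y : D.alg R n) :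
    D.toLim n X * D.toLim (n + 1) (d * D.incl (Nat.le_succ n) Y) = 0 := by
  rw [← D.toLim_succ, ← map_mul, (D.commute_a R n X).eq, mul_assoc, ← mul_assoc (D.a R n), h,
    zero_mul, mul_zero, map_zero]

theorem exists_orth_aux (p q : D.Lim R) :
    ∃ x : D.Lim R, star x * x = star q * q ∧ p * x = 0 := by
  obtain ⟨n, X, Y, hX, hY⟩ : ∃ (n : ℕ) (X Y : D.alg R n),
      p = D.toLim n X ∧ q = D.toLim n Y :=
    DirectLimit.exists_eq_mk₂ (D.rho R) p q
  obtain ⟨d, h1, h2⟩ := D.exists_isometry R n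
  refine ⟨D.toLim (n + 1) (d * D.incl (Nat.le_succ n) Y), ?_, ?_⟩
  · rw [D.toLim_isometry R n d h1, hY, map_mul, map_star]
  · rw [hX, D.toLim_orth R n d h2]

instance : HasOrthogonal (D.Lim R) := HasOrthogonal.of_exists (D.exists_orth_aux R)

/-- `K₀` of a full `E`-C*-algebra `R` (a unital C*-algebra containing `E` in its centre): the
Grothendieck group of `Pr R_→ / ∼₀`. The construction uses only the structure of `R` as an
involutive unital `E`-algebra. -/
def K₀Full : Type _ := Algebra.GrothendieckAddGroup (MvN (D.Lim R))

instance : AddCommGroup (D.K₀Full R) :=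
  inferInstanceAs (AddCommGroup (Algebra.GrothendieckAddGroup (MvN (D.Lim R))))

variable {R}

/-- The Grothendieck map, as a function of the class of a projection. -/
def K₀Of : MvN (D.Lim R) →+ D.K₀Full R := Algebra.GrothendieckAddGroup.of

/-- The class `[P]₀` of a projection of `R_→`. -/
def K₀Class (P : Proj (D.Lim R)) : D.K₀Full R := D.K₀Of (MvN.mk P)

/-- The universal property of the Grothendieck group. -/
def K₀Lift {A : Type*} [AddCommGroup A] (g : MvN (D.Lim R) →+ A) : D.K₀Full R →+ A :=
  Algebra.GrothendieckAddGroup.lift g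

theorem K₀Lift_of {A : Type*} [AddCommGroup A] (g : MvN (D.Lim R) →+ A) (a : MvN (D.Lim R)) :
    D.K₀Lift g (D.K₀Of a) = g a :=
  DFunLike.congr_fun (Algebra.GrothendieckAddGroup.lift.symm_apply_apply g) a

theorem K₀Full_hom_ext {A : Type*} [AddCommGroup A] {g h : D.K₀Full R →+ A}
    (H : ∀ P : Proj (D.Lim R), g (D.K₀Class P) = h (D.K₀Class P)) : g = h := by
  apply Algebra.GrothendieckAddGroup.lift.symm.injective
  apply AddMonoidHom.ext
  intro a
  obtain ⟨p, rfl⟩ : ∃ p, MvN.mk p = a := Quotient.exists_rep a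
  exact H p

/-- `K₀(φ)`, `[P]₀ ↦ [φ_→ P]₀`, for a unital `E`-linear *-homomorphism `φ`. -/
def K₀FullMap (φ : R →⋆ₐ[E] R₁) : D.K₀Full R →+ D.K₀Full R₁ :=
  D.K₀Lift (D.K₀Of.comp (MvN.map (D.limMap φ)))

theorem K₀FullMap_class (φ : R →⋆ₐ[E] R₁) (P : Proj (D.Lim R)) :
    D.K₀FullMap φ (D.K₀Class P) = D.K₀Class (P.map (D.limMap φ)) :=
  D.K₀Lift_of _ _

theorem K₀FullMap_comp (ψ : R₁ →⋆ₐ[E] R₂) (φ : R →⋆ₐ[E] R₁) :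
    D.K₀FullMap (ψ.comp φ) = (D.K₀FullMap ψ).comp (D.K₀FullMap φ) := by
  apply D.K₀Full_hom_ext
  intro P
  rw [AddMonoidHom.comp_apply, K₀FullMap_class, K₀FullMap_class, K₀FullMap_class, limMap_comp]
  rfl

end

section

variable {E : Type u} {Γ : Type v} [CommRing E] [StarRing E] [Group Γ] (D : Datum E Γ)
variable (F : Type w) [NonUnitalRing F] [StarRing F] [Module E F] [IsScalarTower E F F]
  [SMulCommClass E F F] [StarModule E F]
variable {G : Type*} [NonUnitalRing G] [StarRing G] [Module E G] [IsScalarTower E G G]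
  [SMulCommClass E G G] [StarModule E G]

/-- The projection `π : F̌ → E`, `(α, x) ↦ α`, where `F̌ = Unitization E F` is `E × F` with
multiplication `(α, x)(β, y) = (αβ, αy + βx + xy)` and involution `(α, x)* = (α*, x*)`. -/
def unitProj : Unitization E F →⋆ₐ[E] E :=
  { Unitization.fstHom E F with map_star' := fun _ => rfl }

/-- `K₀(F)`, the kernel of `K₀(π) : K₀(F̌) → K₀(E)`, for an `E`-C*-algebra `F`. -/
def K₀ : AddSubgroup (D.K₀Full (Unitization E F)) :=
  (D.K₀FullMap (unitProj F)).ker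

variable {F}

theorem unitProj_comp (φ : F →⋆ₙₐ[E] G) :
    (unitProj G).comp (Unitization.starMap φ) = unitProj F := by
  ext x
  change (Unitization.starMap φ (x : Unitization E F)).fst = (x : Unitization E F).fst
  simp

/-- `K₀(φ) : K₀(F) → K₀(G)`, the restriction of `K₀(φ̌)`, where `φ̌ (α, x) = (α, φ x)`. -/
def K₀Map (φ : F →⋆ₙₐ[E] G) : D.K₀ F →+ D.K₀ G :=
  ((D.K₀FullMap (Unitization.starMap φ)).comp (D.K₀ F).subtype).codRestrict (D.K₀ G)
    (fun a => by
      have h : (D.K₀FullMap (unitProj G)) (D.K₀FullMap (Unitization.starMap φ) a.1) = 0 := by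
        rw [← AddMonoidHom.comp_apply, ← K₀FullMap_comp, unitProj_comp]
        exact a.2
      exact h)

end

end Datum

end ProjK

namespace ProjK

universe u v w

/-! ## Close projections in Banach *-rings -/

section CloseProjections

/-! The group `K₀Full` is generated by classes of projections of the inductive limit, and each such
projection lifts to a projection `Q` at a finite stage `n`, because the equations `X * X = X` and
`star X = X` already hold after finitely many transition maps (`exists_proj_toLim`). A homotopy `Φ`
from `φ` to `ψ` moves `Q` through projections of `Ǧ_n`. If `Q` has coefficients `(α_t, x_t)`, its
image under `Φ s` has coefficients `(α_t, Φ s x_t)`, which are continuous in `s`. Projections joined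
by a path are Murray-von Neumann equivalent (`rel_of_path_unitization`), so the two ends have the
same class in the limit. Homotopic morphisms thus agree on `K₀` (`K₀Map_eq_of_homotopic`).

For the equivalence along a path no C*-norm on `Ǧ_n` is needed: it holds in every complete normed
ring with continuous involution in which 4 is invertible. So `Ǧ` and `Ǧ_n` receive `ℓ¹`-norms, for
which completeness and continuity are read off coordinatewise. Close projections are compared by the
partial isometry `k * q * p`, where `k` is an inverse square root of `1 - (p - q)²`. The root comes
from the Catalan power series, whose sum `w` solves `w = g + w²`, so that `(1 - 2w)² = 1 - 4g`.

The statements on homotopies and homotopic algebras follow by functoriality. A contractible algebra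
is homotopic to zero through zero maps, and `K₀` of the zero algebra vanishes because its
unitization is `E`. -/

theorem catalan_le_four_pow (n : ℕ) : catalan n ≤ 4 ^ n := by
  rw [catalan_eq_centralBinom_div]
  refine (Nat.div_le_self _ _).trans ?_
  rw [Nat.centralBinom]
  calc (2 * n).choose n ≤ 2 ^ (2 * n) := Nat.choose_le_two_pow _ _
    _ = 4 ^ n := by rw [pow_mul]; norm_num

variable {A : Type*} [NormedRing A]

/-- The norm of `1` is not assumed to be at most 1, so powers are estimated only for positive
exponents; the series has no constant term. -/
theorem norm_catalan_term_le (g : A) (n : ℕ) :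
    ‖catalan n • g ^ (n + 1)‖ ≤ ‖g‖ * (4 * ‖g‖) ^ n := by
  calc ‖catalan n • g ^ (n + 1)‖ ≤ catalan n * ‖g ^ (n + 1)‖ := norm_nsmul_le
    _ ≤ 4 ^ n * ‖g‖ ^ (n + 1) := by
        gcongr
        · exact_mod_cast catalan_le_four_pow n
        · exact norm_pow_le' g n.succ_pos
    _ = _ := by rw [mul_pow, pow_succ]; ring

theorem summable_catalan_norm {g : A} (hg : ‖g‖ ≤ 1 / 8) :
    Summable fun n : ℕ => ‖catalan n • g ^ (n + 1)‖ := by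
  refine Summable.of_nonneg_of_le (fun _ => norm_nonneg _) (norm_catalan_term_le g) ?_
  exact (summable_geometric_of_lt_one (by positivity) (by linarith)).mul_left _

/-- The power series `∑ Cₙ gⁿ⁺¹` of the Catalan numbers, the small root of `w = g + w²`. -/
def catalanSeries (g : A) : A := ∑' n : ℕ, catalan n • g ^ (n + 1)

theorem commute_catalanSeries {g x : A} (h : Commute x g) : Commute x (catalanSeries g) :=
  Commute.tsum_right x fun n => (h.pow_right (n + 1)).smul_right (catalan n)

/-- The ratio of the dominating geometric series is at most 1/2, so its sum is at most twice the
first term. The value 1/4 makes `2 * w` have norm at most 1/2, hence `1 - 2 * w` invertible. -/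
theorem norm_catalanSeries_le {g : A} (hg : ‖g‖ ≤ 1 / 8) : ‖catalanSeries g‖ ≤ 1 / 4 := by
  have h4 : 4 * ‖g‖ ≤ 1 / 2 := by linarith
  have hs := (hasSum_geometric_of_lt_one (r := 4 * ‖g‖) (by positivity) (by linarith)).mul_left ‖g‖
  refine (tsum_of_norm_bounded hs (norm_catalan_term_le g)).trans ?_
  calc ‖g‖ * (1 - 4 * ‖g‖)⁻¹ ≤ (1 / 8) * (1 / 2)⁻¹ := by
        have h2 : (1 - 4 * ‖g‖)⁻¹ ≤ (1 / 2 : ℝ)⁻¹ := inv_anti₀ (by norm_num) (by linarith)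
        exact mul_le_mul hg h2 (inv_nonneg.2 (by linarith)) (by norm_num)
    _ = _ := by norm_num

variable [CompleteSpace A]

/-- By the Cauchy product, the square of the series has `∑ C_i C_j` over `i + j = n` as coefficient
of `g ^ (n + 2)`, which is `C_{n+1}` by the Catalan recurrence. Only the first term `g` is missing.
-/
theorem catalanSeries_eq {g : A} (hg : ‖g‖ ≤ 1 / 8) :
    catalanSeries g = g + catalanSeries g * catalanSeries g := by
  have hs := summable_catalan_norm hg
  have h := tsum_mul_tsum_eq_tsum_sum_antidiagonal_of_summable_norm hs hs
  have h0 : catalanSeries g = _ := hs.of_norm.tsum_eq_zero_add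
  conv_lhs => rw [h0]
  unfold catalanSeries
  rw [h]
  simp only [catalan_zero, one_smul, zero_add, pow_one]
  congr 1
  refine tsum_congr fun n => ?_
  rw [catalan_succ', Finset.sum_smul]
  refine Finset.sum_congr rfl fun ij hij => ?_
  rw [smul_mul_smul_comm, ← pow_add, ← Finset.HasAntidiagonal.mem_antidiagonal.1 hij]
  congr 2
  ring

variable [StarRing A] [ContinuousStar A]

theorem star_catalanSeries {g : A} (h : star g = g) : star (catalanSeries g) = catalanSeries g := by
  rw [catalanSeries, tsum_star]
  exact tsum_congr fun n => by rw [star_nsmul, star_pow, h]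

/-- An inverse square root of `1 - 4g` for small self-adjoint `g`. -/
theorem exists_inv_sqrt {g : A} (hg : ‖g‖ ≤ 1 / 8) (hs : star g = g) :
    ∃ k : A, star k = k ∧ k * k * (1 - 4 * g) = 1 ∧ ∀ x, Commute x g → Commute x k := by
  set w := catalanSeries g with hw
  have hn : ‖2 * w‖ < 1 := by
    have := norm_catalanSeries_le hg
    rw [two_mul]
    refine (norm_add_le _ _).trans_lt ?_
    linarith
  set U := Units.oneSub (2 * w) hn with hU
  have hUv : (U : A) = 1 - 2 * w := rfl
  have hcomm : ∀ x, Commute x g → Commute x (↑U⁻¹ : A) := fun x hx => by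
    have : Commute x (U : A) := by
      rw [hUv, two_mul]
      have := commute_catalanSeries hx
      exact (Commute.one_right x).sub_right (this.add_right this)
    exact this.units_inv_right
  refine ⟨(↑U⁻¹ : A), ?_, ?_, hcomm⟩
  · have h1 : star U = U := Units.ext (by
      rw [Units.coe_star, hUv, star_sub, star_one, two_mul, star_add, star_catalanSeries hs])
    rw [← Units.coe_star, star_inv, h1]
  -- Completing the square in `w = g + w²` gives `(1 - 2w)² = 1 - 4g`.
  · have h1 : (1 - 4 * g : A) = (U : A) * U := by
      rw [hUv]
      have e : g = w - w * w := by
        rw [eq_sub_iff_add_eq]; exact (catalanSeries_eq hg).symm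
      rw [e]
      noncomm_ring
    rw [h1, mul_assoc, ← mul_assoc _ (U : A), Units.inv_mul, one_mul, Units.inv_mul]

/-- The element `d = (p - q)²` commutes with `p` and `q`, and `pqp = (1 - d)p`, `qpq = (1 - d)q`.
Correcting `q * p` by an inverse square root of `1 - d` therefore gives a partial isometry from `p`
to `q`. The element `e` plays the role of 1/4, as no scalars are assumed; with `g = e * d` the
expression `1 - 4g` becomes `1 - d`. -/
theorem Proj.rel_of_norm_le {e : A} (he : 4 * e = 1) {p q : Proj A}
    (h : ‖e * ((p.1 - q.1) * (p.1 - q.1))‖ ≤ 1 / 8) : p.Rel q := by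
  obtain ⟨p, hp⟩ := p
  obtain ⟨q, hq⟩ := q
  have hpp : p * p = p := hp.isIdempotentElem.eq
  have hqq : q * q = q := hq.isIdempotentElem.eq
  have hps : star p = p := hp.isSelfAdjoint.star_eq
  have hqs : star q = q := hq.isSelfAdjoint.star_eq
  simp only at h
  obtain ⟨d, hd⟩ : ∃ d, d = (p - q) * (p - q) := ⟨_, rfl⟩
  rw [← hd] at h
  -- An inverse of the central element 4 is central, and likewise self-adjoint.
  have hec : ∀ x : A, e * x = x * e := fun x => by
    have h4 : ∀ y : A, (4 : A) * y = y * 4 := fun y => (Nat.cast_commute 4 y).eq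
    calc e * x = e * x * (4 * e) := by rw [he, mul_one]
      _ = e * (x * 4) * e := by simp only [mul_assoc]
      _ = (e * 4) * x * e := by rw [← h4 x]; simp only [mul_assoc]
      _ = x * e := by rw [← h4 e, he, one_mul]
  have hes : star e = e := by
    have h1 : star e * 4 = 1 := by
      have := congrArg star he
      simpa using this
    calc star e = star e * (4 * e) := by rw [he, mul_one]
      _ = e := by rw [← mul_assoc, h1, one_mul]
  have hdp : p * d = d * p := by
    simp only [hd, mul_sub, sub_mul, mul_assoc, hpp, hqq]
    simp only [← mul_assoc, hpp]
    abel
  have hdq : q * d = d * q := by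
    simp only [hd, mul_sub, sub_mul, mul_assoc, hpp, hqq]
    simp only [← mul_assoc, hqq]
    abel
  have hds : star d = d := by
    rw [hd, star_mul, star_sub, hps, hqs]
  have hgs : star (e * d) = e * d := by rw [star_mul, hes, hds, hec]
  obtain ⟨k, hks, hk, hkc⟩ := exists_inv_sqrt h hgs
  have hkd : k * k * (1 - d) = 1 := by rwa [← mul_assoc, he, one_mul] at hk
  have hkp : p * k = k * p := hkc p (by
    change p * (e * d) = e * d * p
    rw [← mul_assoc, ← hec, mul_assoc, hdp, mul_assoc])
  have hkq : q * k = k * q := hkc q (by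
    change q * (e * d) = e * d * q
    rw [← mul_assoc, ← hec, mul_assoc, hdq, mul_assoc])
  have e1 : p * q * p = (1 - d) * p := by
    simp only [hd, mul_sub, sub_mul, mul_assoc, hpp, hqq, one_mul]
    abel
  have e2 : q * p * q = (1 - d) * q := by
    simp only [hd, mul_sub, sub_mul, mul_assoc, hpp, hqq, one_mul]
    abel
  -- The polar part of `q * p`: its squares are `k² pqp = k² (1 - d) p` and `k² qpq = k² (1 - d) q`.
  refine ⟨k * q * p, ?_, ?_⟩
  · change star (k * q * p) * (k * q * p) = p
    rw [star_mul, star_mul, hks, hps, hqs]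
    calc p * (q * k) * (k * q * p) = p * (q * k * k * q) * p := by simp only [mul_assoc]
      _ = p * (k * k * q) * p := by
          rw [hkq, mul_assoc k, hkq, mul_assoc k, mul_assoc k, mul_assoc k, hqq]
      _ = k * k * (p * q * p) := by
          rw [← mul_assoc p, ← mul_assoc p, hkp, mul_assoc k, hkp]; simp only [mul_assoc]
      _ = p := by rw [e1, ← mul_assoc, hkd, one_mul]
  · change (k * q * p) * star (k * q * p) = q
    rw [star_mul, star_mul, hks, hps, hqs]
    calc k * q * p * (p * (q * k)) = k * (q * (p * p) * q) * k := by simp only [mul_assoc]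
      _ = k * ((1 - d) * q) * k := by rw [hpp, e2]
      _ = k * (1 - d) * (q * k) := by simp only [mul_assoc]
      _ = k * (1 - d) * k * q := by rw [hkq]; simp only [mul_assoc]
      _ = k * k * (1 - d) * q := by
          have : (1 - d) * k = k * (1 - d) := by
            have : d * k = k * d := hkc d (by
              change d * (e * d) = e * d * d
              rw [← mul_assoc, ← hec])
            rw [mul_sub, sub_mul, this, mul_one, one_mul]
          rw [mul_assoc k, this]; simp only [mul_assoc]
      _ = q := by rw [hkd, one_mul]

/-- Projections joined by a continuous path are Murray-von Neumann equivalent. -/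
theorem Proj.rel_of_path {e : A} (he : 4 * e = 1) (P : unitInterval → Proj A)
    (hP : Continuous fun s => (P s).1) (s t : unitInterval) : (P s).Rel (P t) := by
  -- Nearby projections are equivalent, so the class is locally constant, hence constant on the
  -- connected interval.
  have hloc : IsLocallyConstant fun s => (Quotient.mk (Proj.setoid A) (P s)) := by
    rw [IsLocallyConstant.iff_eventually_eq]
    intro s
    have hc : Continuous fun t => ‖e * (((P t).1 - (P s).1) * ((P t).1 - (P s).1))‖ := by
      fun_prop
    have h0 := hc.tendsto s
    simp only [sub_self, mul_zero, norm_zero] at h0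
    filter_upwards [h0.eventually (ge_mem_nhds (by norm_num : (0 : ℝ) < 1 / 8))] with t ht
    exact Quotient.sound (Proj.rel_of_norm_le he ht)
  exact Quotient.exact (hloc.apply_eq_of_preconnectedSpace s t)

end CloseProjections

/-! ## The algebras `R_n` over a Banach *-algebra `R` -/

/-- Equality fails in the zero algebra, which is allowed here. -/
theorem norm_unitary_le_one {E : Type*} [NormedRing E] [StarRing E] [CStarRing E] (x : unitary E) :
    ‖(x : E)‖ ≤ 1 := by
  rcases subsingleton_or_nontrivial E with _ | _
  · simp [Subsingleton.elim (x : E) 0]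
  · exact (CStarRing.norm_of_mem_unitary x.2).le

namespace SchurSystem

section

variable {E : Type u} {Γ : Type v} [CommCStarAlgebra E] [Group Γ] (S : SchurSystem E Γ)
variable {R : Type w} [NormedRing R] [StarRing R] [Algebra E R] [StarModule E R]

variable (R) in
/-- The *-ring `R_n`, as a type of its own, which is to carry the `ℓ¹`-norm of the coefficients
instead of the topology inherited from the matrices. -/
def AlgL1 (n : ℕ) : Type _ := S.alg R n

instance (n : ℕ) : Ring (S.AlgL1 R n) := inferInstanceAs (Ring (S.alg R n))

instance (n : ℕ) : StarRing (S.AlgL1 R n) := inferInstanceAs (StarRing (S.alg R n))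

variable (R) in
/-- `R_n` is identified with `R^{T n}` by means of the coefficients, additively. -/
def coeffEquiv (n : ℕ) : S.AlgL1 R n ≃+ PiLp 1 (fun _ : S.T n => R) where
  toFun M := WithLp.toLp 1 (S.coeff (R := R) (n := n) M)
  invFun X := S.ofCoeff n X
  left_inv M := S.alg_ext fun t => S.coeff_ofCoeff n _ t
  right_inv X := by
    ext t
    exact S.coeff_ofCoeff n _ t
  map_add' _ _ := rfl

instance (n : ℕ) : NormedAddCommGroup (S.AlgL1 R n) :=
  NormedAddCommGroup.induced _ _ (S.coeffEquiv R n) (S.coeffEquiv R n).injective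

theorem isometry_coeffEquiv (n : ℕ) : Isometry (S.coeffEquiv R n) :=
  AddMonoidHomClass.isometry_of_norm _ fun _ => rfl

instance [CompleteSpace R] (n : ℕ) : CompleteSpace (S.AlgL1 R n) :=
  ((S.isometry_coeffEquiv n).isUniformInducing.completeSpace_congr
    (S.coeffEquiv R n).surjective).2 inferInstance

theorem norm_algL1 {n : ℕ} (M : S.AlgL1 R n) : ‖M‖ = ∑ t, ‖S.coeff (R := R) (n := n) M t‖ :=
  PiLp.norm_eq_of_L1 (S.coeffEquiv R n M)

/-- The index set `T n` is finite, so the `ℓ¹`-norm induces the product topology on coefficients. -/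
theorem continuous_algL1_iff {n : ℕ} {X : Type*} [TopologicalSpace X] (g : X → S.AlgL1 R n) :
    Continuous g ↔ ∀ t, Continuous fun x => S.coeff (R := R) (n := n) (g x) t := by
  rw [(S.isometry_coeffEquiv n).isEmbedding.continuous_iff,
    ← (PiLp.homeomorph 1 (fun _ : S.T n => R)).comp_continuous_iff]
  exact continuous_pi_iff

theorem continuous_algL1_coeff {n : ℕ} (t : S.T n) :
    Continuous fun M : S.AlgL1 R n => S.coeff (R := R) (n := n) M t :=
  (S.continuous_algL1_iff id).1 continuous_id t

variable [IsBoundedSMul E R]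

theorem norm_unitary_smul_le (y : unitary E) (x : R) :
    ‖(y : E) • x‖ ≤ ‖x‖ :=
  (norm_smul_le _ _).trans (mul_le_of_le_one_left (norm_nonneg _) (norm_unitary_le_one y))

/-- Multiplication is convolution over the finite group `T n`, twisted by the cocycle. The cocycle
values are contractive, so the usual `ℓ¹` estimate for convolutions applies. -/
theorem norm_algL1_mul_le {n : ℕ} (M N : S.AlgL1 R n) : ‖M * N‖ ≤ ‖M‖ * ‖N‖ := by
  rw [norm_algL1, norm_algL1, norm_algL1]
  calc ∑ u, ‖S.coeff (R := R) (n := n) (M * N) u‖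
      ≤ ∑ u, ∑ q, ‖S.coeff (R := R) (n := n) M (u * q⁻¹)‖ * ‖S.coeff (R := R) (n := n) N q‖ := by
        refine Finset.sum_le_sum fun u _ => ?_
        refine (congrArg norm (S.coeff_mul (R := R) (n := n) M N u)).trans_le ?_
        refine norm_sum_le_of_le _ fun q _ => (norm_mul_le _ _).trans ?_
        exact mul_le_mul_of_nonneg_right (norm_unitary_smul_le _ _) (norm_nonneg _)
    _ = ∑ q, (∑ u, ‖S.coeff (R := R) (n := n) M (u * q⁻¹)‖) * ‖S.coeff (R := R) (n := n) N q‖ := by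
        rw [Finset.sum_comm]
        simp only [Finset.sum_mul]
    _ = ∑ q, (∑ t, ‖S.coeff (R := R) (n := n) M t‖) * ‖S.coeff (R := R) (n := n) N q‖ := by
        refine Finset.sum_congr rfl fun q _ => ?_
        -- Right translation by `q⁻¹` permutes the group.
        rw [← Equiv.sum_comp (Equiv.mulRight q⁻¹) fun t => ‖S.coeff (R := R) (n := n) M t‖]
        rfl
    _ = _ := by rw [Finset.mul_sum]

/-- `R_n` is a normed ring in the `ℓ¹`-norm. -/
instance (n : ℕ) : NormedRing (S.AlgL1 R n) where
  dist_eq := dist_eq_norm_neg_add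
  norm_mul_le := S.norm_algL1_mul_le

instance [ContinuousStar R] (n : ℕ) : ContinuousStar (S.AlgL1 R n) where
  continuous_star := by
    refine (S.continuous_algL1_iff _).2 fun t => ?_
    refine (continuous_star.comp ((continuous_const_smul (S.f (t⁻¹ : S.T n) t : E)).comp
      (S.continuous_algL1_coeff t⁻¹))).congr fun M => ?_
    exact (S.coeff_star (R := R) (n := n) M t).symm

/-- Projections of `R_n` joined by a path with continuous coefficients are equivalent. -/
theorem rel_of_path [CompleteSpace R] [ContinuousStar R] (n : ℕ)
    (P : unitInterval → Proj (S.alg R n))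
    (hP : ∀ t, Continuous fun s => S.coeff (P s).1 t) (s t : unitInterval) :
    (P s).Rel (P t) := by
  -- The quarter comes from the complex scalars in `E`.
  have he : (4 : S.alg R n) * algebraMap E _ (algebraMap ℂ E (1 / 4)) = 1 := by
    rw [show (4 : S.alg R n) = algebraMap E _ (algebraMap ℂ E 4) by rw [map_ofNat, map_ofNat],
      ← map_mul, ← map_mul]
    norm_num
  -- The ring is named explicitly so that the `ℓ¹` topology is used; its ring and star structures
  -- are those of `S.alg R n`, so the conclusion transfers unchanged.
  have key := @Proj.rel_of_path (S.AlgL1 R n) _ _ _ _ _ he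
  exact key P ((S.continuous_algL1_iff _).2 hP) s t

end

end SchurSystem

/-! ## The unitization `F̌` as a Banach *-algebra -/

section

variable {E : Type u} [CommCStarAlgebra E] {F : Type v} [NonUnitalCStarAlgebra F]
  [ECStarAlgebra E F]

variable (E F) in
/-- The `ℓ¹`-norm on `F̌ = E × F`. -/
abbrev unitizationNormedAddCommGroup : NormedAddCommGroup (Unitization E F) :=
  NormedAddCommGroup.induced _ (WithLp 1 (E × F))
    ((Unitization.addEquiv E F).trans (WithLp.linearEquiv 1 ℂ (E × F)).symm.toAddEquiv)
    (AddEquiv.injective _)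

theorem norm_unitization (x : Unitization E F) :
    (unitizationNormedAddCommGroup E F).norm x = ‖x.fst‖ + ‖x.snd‖ :=
  WithLp.prod_norm_eq_of_L1 (WithLp.toLp 1 (x.fst, x.snd))

variable (E F) in
/-- `F̌` is a normed ring in the `ℓ¹`-norm. -/
abbrev unitizationNormedRing : NormedRing (Unitization E F) where
  __ := unitizationNormedAddCommGroup E F
  __ := (inferInstance : Ring (Unitization E F))
  dist_eq := (unitizationNormedAddCommGroup E F).dist_eq
  norm_mul_le x y := by
    rw [norm_unitization, norm_unitization, norm_unitization, Unitization.fst_mul,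
      Unitization.snd_mul]
    have h1 := norm_mul_le x.fst y.fst
    have h2 := ECStarAlgebra.norm_smul_le_mul x.fst y.snd
    have h3 := ECStarAlgebra.norm_smul_le_mul y.fst x.snd
    have h4 := norm_mul_le x.snd y.snd
    have h5 := norm_add₃_le (a := x.fst • y.snd) (b := y.fst • x.snd) (c := x.snd * y.snd)
    -- The four estimates bound the left side by the expansion of `(‖α‖ + ‖x‖)(‖β‖ + ‖y‖)`.
    nlinarith

end

namespace SchurSystem

variable {E : Type u} {Γ : Type v} [CommCStarAlgebra E] [Group Γ] (S : SchurSystem E Γ)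
variable {F : Type w} [NonUnitalCStarAlgebra F] [ECStarAlgebra E F]

/-- Projections of `F̌_n` joined by a path with continuous coefficients are equivalent. -/
theorem rel_of_path_unitization (n : ℕ) (P : unitInterval → Proj (S.alg (Unitization E F) n))
    (hfst : ∀ t, Continuous fun s => (S.coeff (P s).1 t).fst)
    (hsnd : ∀ t, Continuous fun s => (S.coeff (P s).1 t).snd) (s t : unitInterval) :
    (P s).Rel (P t) := by
  -- The `ℓ¹`-norm is only an auxiliary device, local to the proof; the statement mentions just the
  -- topologies of `E` and `F`.
  let _ := unitizationNormedRing E F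
  let e : Unitization E F ≃+ WithLp 1 (E × F) :=
    (Unitization.addEquiv E F).trans (WithLp.linearEquiv 1 ℂ (E × F)).symm.toAddEquiv
  have hi : Isometry e := AddMonoidHomClass.isometry_of_norm _ fun _ => rfl
  have : CompleteSpace (Unitization E F) :=
    (hi.isUniformInducing.completeSpace_congr e.surjective).2 inferInstance
  have : IsBoundedSMul E (Unitization E F) := IsBoundedSMul.of_norm_smul_le fun α x => by
    change (unitizationNormedAddCommGroup E F).norm _ ≤
      _ * (unitizationNormedAddCommGroup E F).norm _
    rw [norm_unitization, norm_unitization, mul_add]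
    exact add_le_add (norm_mul_le _ _) (ECStarAlgebra.norm_smul_le_mul _ _)
  have : ContinuousStar (Unitization E F) := by
    refine ⟨AddMonoidHomClass.continuous_of_bound
      (starAddEquiv : Unitization E F ≃+ Unitization E F) 1 fun x => ?_⟩
    change (unitizationNormedAddCommGroup E F).norm (star x) ≤
      1 * (unitizationNormedAddCommGroup E F).norm x
    rw [norm_unitization, norm_unitization, one_mul, Unitization.fst_star, Unitization.snd_star,
      norm_star, norm_star]
  refine S.rel_of_path n P (fun t => ?_) s t
  rw [hi.isEmbedding.continuous_iff]
  exact (WithLp.prod_continuous_toLp 1 E F).comp ((hfst t).prodMk (hsnd t))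

end SchurSystem

/-! ## Homotopy invariance -/

section

variable {E : Type u} [CommCStarAlgebra E] {F : Type v} [NonUnitalCStarAlgebra F]
  [ECStarAlgebra E F] {G : Type w} [NonUnitalCStarAlgebra G] [ECStarAlgebra E G]

theorem Homotopic.refl (φ : F →⋆ₙₐ[E] G) : Homotopic φ φ :=
  ⟨fun _ => φ, rfl, rfl, fun _ => continuous_const⟩

theorem Homotopic.symm {φ ψ : F →⋆ₙₐ[E] G} (h : Homotopic φ ψ) : Homotopic ψ φ := by
  obtain ⟨Φ, h0, h1, hc⟩ := h
  exact ⟨fun s => Φ (unitInterval.symm s), by simpa using h1, by simpa using h0,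
    fun x => (hc x).comp unitInterval.continuous_symm⟩

/-- Both maps are zero: the composite on `F` is the zero morphism, and on the zero algebra there is
only one morphism. -/
theorem homotopicAlgebras_punit (h : Homotopic (NonUnitalStarAlgHom.id E F) 0) :
    HomotopicAlgebras E F PUnit.{1} := by
  refine ⟨0, 0, h.symm, ?_⟩
  have e : (0 : F →⋆ₙₐ[E] PUnit.{1}).comp 0 = NonUnitalStarAlgHom.id E PUnit.{1} := by
    ext
  rw [e]
  exact Homotopic.refl _

end

namespace Datum

/-! ### Lifting projections of the limit to finite stages -/

section

variable {E : Type u} {Γ : Type v} [CommRing E] [StarRing E] [Group Γ] (D : Datum E Γ)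
variable {R : Type w} [Ring R] [StarRing R] [Algebra E R] [StarModule E R]

/-- Equality in an algebraic inductive limit is witnessed at some finite stage; no closure or norm
is involved. -/
theorem exists_rho_eq {n : ℕ} {X Y : D.alg R n} (h : D.toLim n X = D.toLim n Y) :
    ∃ (k : ℕ) (hk : n ≤ k), D.rho R n k hk X = D.rho R n k hk Y := by
  obtain ⟨k, hk, _, h'⟩ := Quotient.exact h
  exact ⟨k, hk, h'⟩

theorem rho_rho {l m n : ℕ} (h : l ≤ m) (h' : m ≤ n) (X : D.alg R l) :
    D.rho R m n h' (D.rho R l m h X) = D.rho R l n (h.trans h') X :=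
  DirectedSystem.map_map (f := (D.rho R · · ·)) h h' X

/-- Every projection of `R_→` comes from a projection of some `R_n`. -/
theorem exists_proj_toLim (P : Proj (D.Lim R)) :
    ∃ (n : ℕ) (Q : Proj (D.alg R n)), Q.map (D.toLim n) = P := by
  obtain ⟨P, hP⟩ := P
  obtain ⟨n, X, rfl⟩ : ∃ (n : ℕ) (X : D.alg R n), P = D.toLim n X :=
    DirectLimit.exists_eq_mk (D.rho R) P
  obtain ⟨k, hk, h1⟩ := D.exists_rho_eq (X := X * X) (Y := X)
    ((map_mul _ _ _).trans hP.isIdempotentElem.eq)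
  obtain ⟨l, hl, h2⟩ := D.exists_rho_eq (X := star X) (Y := X)
    ((map_star _ _).trans hP.isSelfAdjoint.star_eq)
  -- Idempotency holds from stage `k` on and self-adjointness from stage `l` on.
  refine ⟨max k l, ⟨D.rho R n (max k l) (hk.trans (le_max_left _ _)) X, ?_, ?_⟩,
    Subtype.ext (D.toLim_rho _ X)⟩
  · change _ * _ = _
    rw [← map_mul, ← D.rho_rho hk (le_max_left k l), h1, D.rho_rho]
  · change star _ = _
    rw [← map_star, ← D.rho_rho hl (le_max_right k l), h2, D.rho_rho]

theorem K₀Class_eq {P Q : Proj (D.Lim R)} (h : P.Rel Q) : D.K₀Class P = D.K₀Class Q :=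
  congrArg D.K₀Of (MvN.mk_eq h)

theorem K₀FullMap_id : D.K₀FullMap (StarAlgHom.id E R) = AddMonoidHom.id _ := by
  apply D.K₀Full_hom_ext
  intro P
  rw [K₀FullMap_class, limMap_id]
  rfl

end

/-! ### Functoriality of `K₀` and the zero algebra -/

section

variable {E : Type u} {Γ : Type v} [CommRing E] [StarRing E] [Group Γ] (D : Datum E Γ)
variable {F : Type*} [NonUnitalRing F] [StarRing F] [Module E F] [IsScalarTower E F F]
  [SMulCommClass E F F] [StarModule E F]
variable {G : Type*} [NonUnitalRing G] [StarRing G] [Module E G] [IsScalarTower E G G]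
  [SMulCommClass E G G] [StarModule E G]
variable {H : Type*} [NonUnitalRing H] [StarRing H] [Module E H] [IsScalarTower E H H]
  [SMulCommClass E H H] [StarModule E H]

theorem coe_K₀Map (φ : F →⋆ₙₐ[E] G) (a : D.K₀ F) :
    (D.K₀Map φ a : D.K₀Full (Unitization E G)) = D.K₀FullMap (Unitization.starMap φ) a := rfl

theorem K₀Map_comp (ψ : G →⋆ₙₐ[E] H) (φ : F →⋆ₙₐ[E] G) :
    D.K₀Map (ψ.comp φ) = (D.K₀Map ψ).comp (D.K₀Map φ) := by
  ext a
  rw [AddMonoidHom.comp_apply, coe_K₀Map, coe_K₀Map, coe_K₀Map, Unitization.starMap_comp,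
    K₀FullMap_comp]
  rfl

theorem K₀Map_id : D.K₀Map (NonUnitalStarAlgHom.id E F) = AddMonoidHom.id (D.K₀ F) := by
  ext a
  rw [coe_K₀Map, Unitization.starMap_id, K₀FullMap_id]
  rfl

/-- `K₀` of the zero algebra vanishes, as its unitization is `E`. -/
theorem subsingleton_K₀_of_subsingleton [Subsingleton F] : Subsingleton (D.K₀ F) := by
  -- The projection to `E` has the inclusion of `E` as a left inverse here, so its induced map on
  -- `K₀Full` has trivial kernel.
  have e : (StarAlgHom.ofId E (Unitization E F)).comp (unitProj F) = StarAlgHom.id E _ := by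
    refine StarAlgHom.ext fun x => Unitization.ext ?_ (Subsingleton.elim (α := F) _ _)
    rfl
  have h0 : ∀ a : D.K₀ F, a = 0 := fun a => Subtype.ext <| by
    have h := DFunLike.congr_fun (D.K₀FullMap_id (R := Unitization E F)) a.1
    rw [← e, K₀FullMap_comp, AddMonoidHom.comp_apply,
      show D.K₀FullMap (unitProj F) a.1 = 0 from a.2,
      map_zero] at h
    exact h.symm
  exact ⟨fun a b => (h0 a).trans (h0 b).symm⟩

end

/-! ### Homotopic morphisms and homotopic algebras -/

section

variable {E : Type u} {Γ : Type v} [CommCStarAlgebra E] [Group Γ] (D : Datum E Γ)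
variable {F : Type*} [NonUnitalCStarAlgebra F] [ECStarAlgebra E F]
variable {G : Type*} [NonUnitalCStarAlgebra G] [ECStarAlgebra E G]

theorem K₀FullMap_eq_of_homotopic {φ ψ : F →⋆ₙₐ[E] G} (h : Homotopic φ ψ) :
    D.K₀FullMap (Unitization.starMap φ) = D.K₀FullMap (Unitization.starMap ψ) := by
  obtain ⟨Φ, rfl, rfl, hc⟩ := h
  apply D.K₀Full_hom_ext
  intro P
  obtain ⟨n, Q, rfl⟩ := D.exists_proj_toLim P
  rw [K₀FullMap_class, K₀FullMap_class]
  apply D.K₀Class_eq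
  let g (s : unitInterval) : D.alg (Unitization E F) n →⋆ₙ+* D.alg (Unitization E G) n :=
    (D.algMap n (Unitization.starMap (Φ s)) : D.alg (Unitization E F) n →⋆ₙ+* _)
  have key : (Q.map (g 0)).Rel (Q.map (g 1)) := by
    refine D.rel_of_path_unitization n (fun s => Q.map (g s)) (fun t => ?_) (fun t => ?_) 0 1
    -- The `E`-component is fixed by every unitized morphism; only the second component moves, along
    -- `Φ s`.
    · refine (continuous_const (y := (D.coeff Q.1 t).fst)).congr fun s => ?_
      change _ = (Unitization.starMap (Φ s) (D.coeff Q.1 t)).fst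
      simp [Unitization.algebraMap_eq_inl]
    · refine (hc (D.coeff Q.1 t).snd).congr fun s => ?_
      change _ = (Unitization.starMap (Φ s) (D.coeff Q.1 t)).snd
      simp [Unitization.algebraMap_eq_inl]
  -- On the image of stage `n`, the limit map is by definition the stage map followed by `toLim`.
  exact key.map (D.toLim n)

/-- Homotopy invariance of `K₀`. -/
theorem K₀Map_eq_of_homotopic {φ ψ : F →⋆ₙₐ[E] G} (h : Homotopic φ ψ) :
    D.K₀Map φ = D.K₀Map ψ := by
  ext a
  rw [coe_K₀Map, coe_K₀Map, D.K₀FullMap_eq_of_homotopic h]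

theorem K₀Map_comp_eq_id {φ : F →⋆ₙₐ[E] G} {ψ : G →⋆ₙₐ[E] F}
    (h : Homotopic (φ.comp ψ) (NonUnitalStarAlgHom.id E G)) :
    (D.K₀Map φ).comp (D.K₀Map ψ) = AddMonoidHom.id (D.K₀ G) := by
  rw [← K₀Map_comp, D.K₀Map_eq_of_homotopic h, K₀Map_id]

theorem nonempty_K₀_equiv (h : HomotopicAlgebras E F G) : Nonempty (D.K₀ F ≃+ D.K₀ G) := by
  obtain ⟨φ, ψ, h1, h2⟩ := h
  exact ⟨(D.K₀Map φ).toAddEquiv (D.K₀Map ψ) (D.K₀Map_comp_eq_id h1) (D.K₀Map_comp_eq_id h2)⟩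

end

end Datum

end ProjK

theorem theorem940 {E : Type*} [CommCStarAlgebra E] {Γ : Type*} [Group Γ] (D : ProjK.Datum E Γ)
    {F : Type*} [NonUnitalCStarAlgebra F] [ProjK.ECStarAlgebra E F]
    {G : Type*} [NonUnitalCStarAlgebra G] [ProjK.ECStarAlgebra E G] :
    (∀ φ ψ : F →⋆ₙₐ[E] G, ProjK.Homotopic φ ψ → D.K₀Map φ = D.K₀Map ψ) ∧
    (∀ (φ : F →⋆ₙₐ[E] G) (ψ : G →⋆ₙₐ[E] F), ProjK.IsHomotopy φ ψ →
      (D.K₀Map φ).comp (D.K₀Map ψ) = AddMonoidHom.id (D.K₀ G) ∧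
      (D.K₀Map ψ).comp (D.K₀Map φ) = AddMonoidHom.id (D.K₀ F)) ∧
    (ProjK.HomotopicAlgebras E F G → Nonempty (D.K₀ F ≃+ D.K₀ G)) ∧
    (ProjK.Homotopic (NonUnitalStarAlgHom.id E F) (0 : F →⋆ₙₐ[E] F) →
      ProjK.HomotopicAlgebras E F PUnit.{1}) ∧
    (ProjK.HomotopicAlgebras E F PUnit.{1} → Subsingleton (D.K₀ F)) := by
  refine ⟨fun φ ψ h => D.K₀Map_eq_of_homotopic h,
    fun φ ψ h => ⟨D.K₀Map_comp_eq_id h.2, D.K₀Map_comp_eq_id h.1⟩,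
    D.nonempty_K₀_equiv, ProjK.homotopicAlgebras_punit, fun h => ?_⟩
  obtain ⟨e⟩ := D.nonempty_K₀_equiv h
  have := D.subsingleton_K₀_of_subsingleton (F := PUnit.{1})
  exact e.injective.subsingleton
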